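/- Theorem. Let $A$ be a condensed (associative, unital, not necessarily commutative) ring, and suppose that $A$ is Kaplansky in the following sense: for every set $I$ and every ultrafilter $\mu$ on $I$, any element of the filtered colimit $\varinjlim_{\mu(J)=1} A(\beta J)$ (over the subsets $J\subseteq I$ with $\mu(J)=1$, where $\beta J$ is the Stone–Čech compactification of the discrete set $J$) whose image in $A(\{\mu\})$ is invertible is the image of an invertible element of $A(\beta J)$ for some $J\subseteq I$ with $\mu(J)=1$. Let $K_0(A)$ be the condensed abelian group whose value at an extremally disconnected compact Hausdorff space $S$ is $K_0(A(S))$, the Grothendieck group of the monoid of isomorphism classes of finitely generated projective $A(S)$-modules. Then $K_0(A)$ is discrete, i.e. it is isomorphic to the constant sheaf associated with an abelian group. -/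

import Mathlib

open CategoryTheory Limits Opposite
open scoped TensorProduct

universe u w

namespace KZero

/-! ### Base change of left modules along a homomorphism of associative rings -/

section BaseChange

variable {R S T : Type w} [Ring R] [Ring S] [Ring T] (f : R →+* S) (g : S →+* T)
variable (P P' Q : Type w) [AddCommGroup P] [AddCommGroup P'] [AddCommGroup Q]
  [Module R P] [Module R P'] [Module S Q]

/-- The `S`-submodule of `S ⊗[ℤ] P` generated by the elements `1 ⊗ r p - f r ⊗ p`;
it contains all `s ⊗ r p - s f(r) ⊗ p`. -/
def baseChangeRel : Submodule S (S ⊗[ℤ] P) :=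
  Submodule.span S {x | ∃ (r : R) (p : P), x = (1 : S) ⊗ₜ[ℤ] (r • p) - f r ⊗ₜ[ℤ] p}

/-- The base change `S ⊗_R P` of a left `R`-module `P` along a homomorphism `f : R → S` of
(not necessarily commutative) rings, where `S` is a right `R`-module through `f`:
the quotient of `S ⊗_ℤ P` by the relations `s ⊗ r p = s f(r) ⊗ p`. -/
def BaseChange : Type w := (S ⊗[ℤ] P) ⧸ baseChangeRel f P

instance : AddCommGroup (BaseChange f P) :=
  inferInstanceAs (AddCommGroup ((S ⊗[ℤ] P) ⧸ baseChangeRel f P))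

instance : Module S (BaseChange f P) :=
  inferInstanceAs (Module S ((S ⊗[ℤ] P) ⧸ baseChangeRel f P))

namespace BaseChange

/-- The class of `s ⊗ p` in `S ⊗_R P`. -/
def tmul (s : S) (p : P) : BaseChange f P :=
  Submodule.Quotient.mk (p := baseChangeRel f P) (s ⊗ₜ[ℤ] p)

/-- The canonical `f`-semilinear map `P → S ⊗_R P`, `p ↦ 1 ⊗ p`. -/
def ι : P →ₛₗ[f] BaseChange f P where
  toFun p := tmul f P 1 p
  map_add' p q := by
    simp only [tmul, TensorProduct.tmul_add]
    rfl
  map_smul' r p := by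
    have h : (f r • tmul f P 1 p : BaseChange f P) = tmul f P (f r) p := by
      change Submodule.Quotient.mk (p := baseChangeRel f P) (f r • ((1 : S) ⊗ₜ[ℤ] p)) = _
      rw [TensorProduct.smul_tmul', smul_eq_mul, mul_one]
      rfl
    rw [h]
    exact (Submodule.Quotient.eq _).2 (Submodule.subset_span ⟨r, p, rfl⟩)

variable {P P' Q}

/-- Semilinear maps out of `P` extend to linear maps out of `S ⊗_R P`. -/
def lift (φ : P →ₛₗ[f] Q) : BaseChange f P →ₗ[S] Q :=
  (baseChangeRel f P).liftQ
    (TensorProduct.AlgebraTensorModule.lift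
      (LinearMap.toSpanSingleton S (P →ₗ[ℤ] Q) φ.toAddMonoidHom.toIntLinearMap)) (by
    rw [baseChangeRel, Submodule.span_le]
    rintro _ ⟨r, p, rfl⟩
    simp)

@[simp]
theorem lift_ι (φ : P →ₛₗ[f] Q) (p : P) : lift f φ (ι f P p) = φ p := by
  change (baseChangeRel f P).liftQ _ _ (Submodule.Quotient.mk _) = _
  rw [Submodule.liftQ_apply]
  simp

variable {f}

theorem hom_ext {φ ψ : BaseChange f P →ₗ[S] Q} (h : ∀ p, φ (ι f P p) = ψ (ι f P p)) : φ = ψ := by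
  refine Submodule.linearMap_qext _ (TensorProduct.AlgebraTensorModule.ext fun s p => ?_)
  have hs : (Submodule.Quotient.mk (p := baseChangeRel f P) (s ⊗ₜ[ℤ] p) : BaseChange f P)
      = s • ι f P p := by
    change _ = Submodule.Quotient.mk (p := baseChangeRel f P) (s • ((1 : S) ⊗ₜ[ℤ] p))
    rw [TensorProduct.smul_tmul', smul_eq_mul, mul_one]
  change φ (Submodule.Quotient.mk (p := baseChangeRel f P) (s ⊗ₜ[ℤ] p) : BaseChange f P)
    = ψ (Submodule.Quotient.mk (p := baseChangeRel f P) (s ⊗ₜ[ℤ] p) : BaseChange f P)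
  rw [hs, map_smul, map_smul, h]

variable (f)

/-- Base change of linear maps. -/
def map (φ : P →ₗ[R] P') : BaseChange f P →ₗ[S] BaseChange f P' :=
  lift f ((ι f P').comp φ)

@[simp]
theorem map_ι (φ : P →ₗ[R] P') (p : P) : map f φ (ι f P p) = ι f P' (φ p) := by
  simp [map]

/-- Base change of linear isomorphisms. -/
def congr (e : P ≃ₗ[R] P') : BaseChange f P ≃ₗ[S] BaseChange f P' :=
  LinearEquiv.ofLinearMap (map f e.toLinearMap) (map f e.symm.toLinearMap)
    (hom_ext fun p => by simp) (hom_ext fun p => by simp)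

variable (P P')

/-- Base change commutes with binary direct sums. -/
def prodEquiv : BaseChange f (P × P') ≃ₗ[S] BaseChange f P × BaseChange f P' :=
  LinearEquiv.ofLinearMap
    ((map f (LinearMap.fst R P P')).prod (map f (LinearMap.snd R P P')))
    ((map f (LinearMap.inl R P P')).coprod (map f (LinearMap.inr R P P')))
    (by
      refine LinearMap.prod_ext (hom_ext fun p => ?_) (hom_ext fun p => ?_) <;> simp)
    (hom_ext fun p => by simp [← map_add])

/-- The base change of `R^n` is `S^n`. -/
def piEquiv (n : ℕ) : BaseChange f (Fin n → R) ≃ₗ[S] (Fin n → S) :=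
  LinearEquiv.ofLinearMap
    (lift f
      { toFun := fun v i => f (v i)
        map_add' := fun v v' => by ext; simp
        map_smul' := fun r v => by ext; simp })
    (Fintype.linearCombination S fun i => ι f (Fin n → R) (Pi.single i 1))
    (by
      refine LinearMap.pi_ext' fun i => LinearMap.ext_ring ?_
      ext j
      by_cases h : i = j
      · subst h; simp
      · simp [Ne.symm h])
    (hom_ext fun v => by
      simp only [LinearMap.comp_apply, lift_ι, LinearMap.id_apply,
        Fintype.linearCombination_apply]
      change ∑ i, f (v i) • ι f (Fin n → R) (Pi.single i 1) = _
      simp only [← LinearMap.map_smulₛₗ, ← map_sum]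
      congr 1
      exact (pi_eq_sum_univ' v).symm)

@[simp]
theorem piEquiv_ι (n : ℕ) (v : Fin n → R) (i : Fin n) :
    piEquiv f n (ι f (Fin n → R) v) i = f (v i) := by
  exact congrFun (lift_ι f (Q := Fin n → S) _ v) i

/-- Base change along the identity. -/
def idEquiv : BaseChange (RingHom.id R) P ≃ₗ[R] P :=
  LinearEquiv.ofLinearMap (lift (RingHom.id R) LinearMap.id) (ι (RingHom.id R) P)
    (by ext; simp) (hom_ext fun p => by simp)

variable {P}

/-- A map out of `P` that is semilinear along a composite extends to a semilinear map out of
the base change along the first homomorphism. -/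
def liftSemi {N : Type w} [AddCommGroup N] [Module T N] (φ : P →ₛₗ[g.comp f] N) :
    BaseChange f P →ₛₗ[g] N :=
  letI : Module S N := Module.compHom N g
  letI ψ : BaseChange f P →ₗ[S] N := lift f
    { toFun := φ
      map_add' := map_add φ
      map_smul' := fun r p => LinearMap.map_smulₛₗ φ r p }
  { toFun := ψ
    map_add' := map_add ψ
    map_smul' := map_smul ψ }

@[simp]
theorem liftSemi_ι {N : Type w} [AddCommGroup N] [Module T N] (φ : P →ₛₗ[g.comp f] N) (p : P) :
    liftSemi f g φ (ι f P p) = φ p :=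
  let _ : Module S N := Module.compHom N g
  lift_ι f (Q := N) _ p

theorem hom_ext_semi {N : Type w} [AddCommGroup N] [Module T N] {φ ψ : BaseChange f P →ₛₗ[g] N}
    (h : ∀ p, φ (ι f P p) = ψ (ι f P p)) (x : BaseChange f P) : φ x = ψ x := by
  let _ : Module S N := Module.compHom N g
  let φ' : BaseChange f P →ₗ[S] N :=
    { toFun := φ, map_add' := map_add φ, map_smul' := LinearMap.map_smulₛₗ φ }
  let ψ' : BaseChange f P →ₗ[S] N :=
    { toFun := ψ, map_add' := map_add ψ, map_smul' := LinearMap.map_smulₛₗ ψ }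
  have : φ' = ψ' := hom_ext h
  exact LinearMap.congr_fun this x

variable (P)

/-- The composite of the canonical maps `P → S ⊗_R P → T ⊗_S (S ⊗_R P)`. -/
def ιι : P →ₛₗ[g.comp f] BaseChange g (BaseChange f P) where
  toFun p := ι g _ (ι f P p)
  map_add' p q := by simp
  map_smul' r p := by simp [LinearMap.map_smulₛₗ]

/-- Base change along a composite is iterated base change. -/
def compEquiv : BaseChange (g.comp f) P ≃ₗ[T] BaseChange g (BaseChange f P) :=
  LinearEquiv.ofLinearMap (lift (g.comp f) (ιι f g P)) (lift g (liftSemi f g (ι (g.comp f) P)))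
    (hom_ext fun x => by
      refine hom_ext_semi f g (φ := ((lift (g.comp f) (ιι f g P) ∘ₗ
        lift g (liftSemi f g (ι (g.comp f) P))).comp (ι g _))) (ψ := ι g _) (fun p => ?_) x
      simp [ιι])
    (hom_ext fun p => by simp [ιι])

theorem exists_retract [Module.Finite R P] [Module.Projective R P] :
    ∃ (n : ℕ) (i : P →ₗ[R] (Fin n → R)) (q : (Fin n → R) →ₗ[R] P), q ∘ₗ i = LinearMap.id := by
  obtain ⟨n, q, hq⟩ := Module.Finite.exists_fin' R P
  obtain ⟨i, hi⟩ := Module.projective_lifting_property q LinearMap.id hq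
  exact ⟨n, i, q, hi⟩

theorem map_comp_map {i : P →ₗ[R] P'} {q : P' →ₗ[R] P} (h : q ∘ₗ i = LinearMap.id) :
    map f q ∘ₗ map f i = LinearMap.id :=
  hom_ext fun p => by simpa using congrArg (ι f P) (LinearMap.congr_fun h p)

instance [Module.Finite R P] [Module.Projective R P] : Module.Finite S (BaseChange f P) := by
  obtain ⟨n, i, q, h⟩ := exists_retract (R := R) P
  have h' := map_comp_map f _ _ h
  refine Module.Finite.of_surjective (map f q ∘ₗ (piEquiv f n).symm.toLinearMap) ?_
  intro x
  exact ⟨piEquiv f n (map f i x), by simpa using LinearMap.congr_fun h' x⟩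

instance [Module.Finite R P] [Module.Projective R P] : Module.Projective S (BaseChange f P) := by
  obtain ⟨n, i, q, h⟩ := exists_retract (R := R) P
  have h' := map_comp_map f _ _ h
  refine Module.Projective.of_split (M := Fin n → S) ((piEquiv f n).toLinearMap ∘ₗ map f i)
    (map f q ∘ₗ (piEquiv f n).symm.toLinearMap) ?_
  ext x
  simpa using LinearMap.congr_fun h' x

end BaseChange

end BaseChange

/-! ### The Grothendieck group of finitely generated projective modules -/

/-- Finitely generated projective left modules over an associative ring. -/
structure FGProj (R : Type w) [Ring R] where
  /-- The underlying type. -/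
  carrier : Type w
  [addCommGroup : AddCommGroup carrier]
  [module : Module R carrier]
  [finite : Module.Finite R carrier]
  [projective : Module.Projective R carrier]

attribute [instance] FGProj.addCommGroup FGProj.module FGProj.finite FGProj.projective

section Monoid

variable (R : Type w) [Ring R]

/-- Isomorphism of finitely generated projective modules. -/
instance FGProj.setoid : Setoid (FGProj R) where
  r P Q := Nonempty (P.carrier ≃ₗ[R] Q.carrier)
  iseqv := ⟨fun _ => ⟨LinearEquiv.refl R _⟩, fun ⟨e⟩ => ⟨e.symm⟩, fun ⟨e⟩ ⟨e'⟩ => ⟨e.trans e'⟩⟩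

/-- Isomorphism classes of finitely generated projective modules. -/
def Vect : Type (w + 1) := Quotient (FGProj.setoid R)

variable {R}

/-- The isomorphism class of a finitely generated projective module. -/
def Vect.mk (P : Type w) [AddCommGroup P] [Module R P] [Module.Finite R P]
    [Module.Projective R P] : Vect R := Quotient.mk _ ⟨P⟩

theorem Vect.mk_eq_iff {P Q : Type w} [AddCommGroup P] [Module R P] [Module.Finite R P]
    [Module.Projective R P] [AddCommGroup Q] [Module R Q] [Module.Finite R Q]
    [Module.Projective R Q] : (Vect.mk P : Vect R) = Vect.mk Q ↔ Nonempty (P ≃ₗ[R] Q) :=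
  Quotient.eq (r := FGProj.setoid R)

theorem Vect.ind {motive : Vect R → Prop}
    (h : ∀ (P : Type w) [AddCommGroup P] [Module R P] [Module.Finite R P]
      [Module.Projective R P], motive (Vect.mk P)) (x : Vect R) : motive x :=
  Quotient.inductionOn x fun P => h P.carrier

instance : Zero (Vect R) := ⟨Vect.mk PUnit⟩

instance : Add (Vect R) :=
  ⟨Quotient.map₂ (fun P Q => ⟨P.carrier × Q.carrier⟩)
    fun _ _ ⟨e⟩ _ _ ⟨e'⟩ => ⟨LinearEquiv.prodCongr e e'⟩⟩

/-- Isomorphism classes of finitely generated projective modules form a commutative monoid under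
direct sum. -/
instance : AddCommMonoid (Vect R) where
  add_assoc x y z := by
    induction x using Vect.ind
    induction y using Vect.ind
    induction z using Vect.ind
    exact Vect.mk_eq_iff.2 ⟨LinearEquiv.prodAssoc R _ _ _⟩
  zero_add x := by
    induction x using Vect.ind
    exact Vect.mk_eq_iff.2 ⟨LinearEquiv.uniqueProd⟩
  add_zero x := by
    induction x using Vect.ind
    exact Vect.mk_eq_iff.2 ⟨LinearEquiv.prodUnique⟩
  add_comm x y := by
    induction x using Vect.ind
    induction y using Vect.ind
    exact Vect.mk_eq_iff.2 ⟨LinearEquiv.prodComm R _ _⟩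
  nsmul := nsmulRec

theorem Vect.mk_add_mk (P Q : Type w) [AddCommGroup P] [Module R P] [Module.Finite R P]
    [Module.Projective R P] [AddCommGroup Q] [Module R Q] [Module.Finite R Q]
    [Module.Projective R Q] : (Vect.mk P + Vect.mk Q : Vect R) = Vect.mk (P × Q) := rfl

theorem Vect.zero_def : (0 : Vect R) = Vect.mk PUnit := rfl

/-- Every finitely generated projective module is the image of an endomorphism of some `R^n`, so
the isomorphism classes form a small set. -/
instance Vect.small : Small.{w} (Vect R) := by
  let α := Σ n : ℕ, {e : (Fin n → R) →ₗ[R] (Fin n → R) //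
    Module.Finite R (LinearMap.range e) ∧ Module.Projective R (LinearMap.range e)}
  let F : α → Vect R := fun a =>
    haveI := a.2.2.1
    haveI := a.2.2.2
    Vect.mk (LinearMap.range a.2.1)
  refine small_of_surjective (f := F) fun x => ?_
  induction x using Vect.ind with
  | h P =>
    obtain ⟨n, i, q, h⟩ := BaseChange.exists_retract (R := R) P
    have hq : Function.Surjective q := fun p => ⟨i p, LinearMap.congr_fun h p⟩
    have hi : Function.Injective i := fun p p' hp => by
      have := congrArg q hp
      simpa [← LinearMap.comp_apply, h] using this
    have hr : LinearMap.range (i ∘ₗ q) = LinearMap.range i :=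
      LinearMap.range_comp_of_range_eq_top i (LinearMap.range_eq_top.2 hq)
    let e : P ≃ₗ[R] LinearMap.range (i ∘ₗ q) :=
      (LinearEquiv.ofInjective i hi).trans (LinearEquiv.ofEq _ _ hr.symm)
    have h₁ : Module.Finite R (LinearMap.range (i ∘ₗ q)) := Module.Finite.equiv e
    have h₂ : Module.Projective R (LinearMap.range (i ∘ₗ q)) := Module.Projective.of_equiv e
    exact ⟨⟨n, i ∘ₗ q, h₁, h₂⟩, Vect.mk_eq_iff.2 ⟨e.symm⟩⟩

variable {S T : Type w} [Ring S] [Ring T] (f : R →+* S) (g : S →+* T)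

/-- Base change of isomorphism classes of finitely generated projective modules. -/
def Vect.map : Vect R →+ Vect S where
  toFun := Quotient.map (fun P => ⟨BaseChange f P.carrier⟩)
    fun _ _ ⟨e⟩ => ⟨BaseChange.congr f e⟩
  map_zero' := by
    refine Vect.mk_eq_iff.2 ⟨?_⟩
    have : Subsingleton (BaseChange f (PUnit.{w + 1})) := by
      have h : (LinearMap.id : BaseChange f (PUnit.{w + 1}) →ₗ[S] _) = 0 :=
        BaseChange.hom_ext fun p => by
          rw [Subsingleton.elim p 0, map_zero]
          simp only [map_zero]
      exact ⟨fun x y => (LinearMap.congr_fun h x).trans (LinearMap.congr_fun h y).symm⟩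
    exact LinearEquiv.ofSubsingleton _ _
  map_add' x y := by
    induction x using Vect.ind
    induction y using Vect.ind
    exact Vect.mk_eq_iff.2 ⟨BaseChange.prodEquiv f _ _⟩

theorem Vect.map_mk (P : Type w) [AddCommGroup P] [Module R P] [Module.Finite R P]
    [Module.Projective R P] : Vect.map f (Vect.mk P) = Vect.mk (BaseChange f P) := rfl

theorem Vect.map_id : Vect.map (RingHom.id R) = AddMonoidHom.id (Vect R) := by
  ext x
  induction x using Vect.ind
  exact Vect.mk_eq_iff.2 ⟨BaseChange.idEquiv _⟩

theorem Vect.map_comp : Vect.map (g.comp f) = (Vect.map g).comp (Vect.map f) := by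
  ext x
  induction x using Vect.ind
  exact Vect.mk_eq_iff.2 ⟨BaseChange.compEquiv f g _⟩

end Monoid

/-! ### Projective modules over a product of two rings -/

section Prod

variable {R S : Type w} [Ring R] [Ring S]

/-- The sum `P ⊕ Q` of an `R`-module and an `S`-module, as a module over `R × S`. -/
def ProdMod (P Q : Type w) : Type w := P × Q

variable (P Q : Type w) [AddCommGroup P] [AddCommGroup Q] [Module R P] [Module S Q]

instance : AddCommGroup (ProdMod P Q) := inferInstanceAs (AddCommGroup (P × Q))

instance : Module (R × S) (ProdMod P Q) where
  smul a x := (a.1 • x.1, a.2 • x.2)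
  one_smul x := Prod.ext (one_smul R x.1) (one_smul S x.2)
  mul_smul a b x := Prod.ext (mul_smul a.1 b.1 x.1) (mul_smul a.2 b.2 x.2)
  smul_zero a := Prod.ext (smul_zero a.1) (smul_zero a.2)
  smul_add a x y := Prod.ext (smul_add a.1 x.1 y.1) (smul_add a.2 x.2 y.2)
  add_smul a b x := Prod.ext (add_smul a.1 b.1 x.1) (add_smul a.2 b.2 x.2)
  zero_smul x := Prod.ext (zero_smul R x.1) (zero_smul S x.2)

variable {P Q} in
/-- The element `(p, q)` of `P ⊕ Q`. -/
def ProdMod.mk (p : P) (q : Q) : ProdMod P Q := (p, q)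

variable {P Q} in
theorem ProdMod.mk_add (p p' : P) (q q' : Q) :
    ProdMod.mk (p + p') (q + q') = ProdMod.mk p q + ProdMod.mk p' q' := rfl

variable {P Q} in
theorem ProdMod.smul_mk (r : R) (s : S) (p : P) (q : Q) :
    ((r, s) : R × S) • ProdMod.mk p q = ProdMod.mk (r • p) (s • q) := rfl

theorem ProdMod.exists_retract [Module.Finite R P] [Module.Projective R P]
    [Module.Finite S Q] [Module.Projective S Q] :
    ∃ (n m : ℕ) (i : ProdMod P Q →ₗ[R × S] ((Fin n → R × S) × (Fin m → R × S)))
      (q : ((Fin n → R × S) × (Fin m → R × S)) →ₗ[R × S] ProdMod P Q),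
      q ∘ₗ i = LinearMap.id := by
  obtain ⟨n, i, q, h⟩ := BaseChange.exists_retract (R := R) P
  obtain ⟨m, i', q', h'⟩ := BaseChange.exists_retract (R := S) Q
  refine ⟨n, m,
    { toFun := fun x => (fun k => (i x.1 k, 0), fun k => (0, i' x.2 k))
      map_add' := fun x y => ?_
      map_smul' := fun a x => ?_ },
    { toFun := fun v => (q fun k => (v.1 k).1, q' fun k => (v.2 k).2)
      map_add' := fun v v' => Prod.ext (map_add q (fun k => (v.1 k).1) fun k => (v'.1 k).1)
        (map_add q' (fun k => (v.2 k).2) fun k => (v'.2 k).2)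
      map_smul' := fun a v => Prod.ext (map_smul q a.1 fun k => (v.1 k).1)
        (map_smul q' a.2 fun k => (v.2 k).2) }, ?_⟩
  · have h₁ : i (x + y).1 = i x.1 + i y.1 := map_add i x.1 y.1
    have h₂ : i' (x + y).2 = i' x.2 + i' y.2 := map_add i' x.2 y.2
    ext k <;> simp [h₁, h₂]
  · have h₁ : i (a • x).1 = a.1 • i x.1 := map_smul i a.1 x.1
    have h₂ : i' (a • x).2 = a.2 • i' x.2 := map_smul i' a.2 x.2
    ext k <;> simp [h₁, h₂]
  · exact LinearMap.ext fun x =>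
      Prod.ext (LinearMap.congr_fun h x.1) (LinearMap.congr_fun h' x.2)

instance [Module.Finite R P] [Module.Projective R P] [Module.Finite S Q] [Module.Projective S Q] :
    Module.Finite (R × S) (ProdMod P Q) := by
  obtain ⟨n, m, i, q, h⟩ := ProdMod.exists_retract (R := R) (S := S) P Q
  exact Module.Finite.of_surjective q fun x => ⟨i x, LinearMap.congr_fun h x⟩

instance [Module.Finite R P] [Module.Projective R P] [Module.Finite S Q] [Module.Projective S Q] :
    Module.Projective (R × S) (ProdMod P Q) := by
  obtain ⟨n, m, i, q, h⟩ := ProdMod.exists_retract (R := R) (S := S) P Q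
  exact Module.Projective.of_split i q h

/-- The base change of `P ⊕ Q` to the first factor is `P`. -/
def ProdMod.fstEquiv : BaseChange (RingHom.fst R S) (ProdMod P Q) ≃ₗ[R] P :=
  LinearEquiv.ofLinearMap
    (BaseChange.lift (RingHom.fst R S)
      { toFun := fun x => x.1, map_add' := fun _ _ => rfl, map_smul' := fun _ _ => rfl })
    { toFun := fun p => BaseChange.ι (RingHom.fst R S) (ProdMod P Q) (ProdMod.mk p 0)
      map_add' := fun p p' => by
        have h := ProdMod.mk_add (P := P) (Q := Q) p p' 0 0
        rw [add_zero] at h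
        rw [h, map_add]
      map_smul' := fun r p => by
        have h := ProdMod.smul_mk (P := P) (Q := Q) r (0 : S) p 0
        rw [smul_zero] at h
        rw [← h, LinearMap.map_smulₛₗ]
        rfl }
    (by ext p; exact BaseChange.lift_ι _ _ _)
    (BaseChange.hom_ext fun x => by
      obtain ⟨p, q⟩ := x
      have h := ProdMod.smul_mk (1 : R) (0 : S) p q
      rw [one_smul, zero_smul] at h
      have h' := LinearMap.map_smulₛₗ (BaseChange.ι (RingHom.fst R S) (ProdMod P Q))
        ((1, 0) : R × S) (ProdMod.mk p q)
      rw [h, RingHom.coe_fst, one_smul] at h'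
      exact (congrArg (fun z => BaseChange.ι (RingHom.fst R S) (ProdMod P Q) (ProdMod.mk z 0))
        (BaseChange.lift_ι (RingHom.fst R S) _ (ProdMod.mk p q))).trans h')

/-- The base change of `P ⊕ Q` to the second factor is `Q`. -/
def ProdMod.sndEquiv : BaseChange (RingHom.snd R S) (ProdMod P Q) ≃ₗ[S] Q :=
  LinearEquiv.ofLinearMap
    (BaseChange.lift (RingHom.snd R S)
      { toFun := fun x => x.2, map_add' := fun _ _ => rfl, map_smul' := fun _ _ => rfl })
    { toFun := fun p => BaseChange.ι (RingHom.snd R S) (ProdMod P Q) (ProdMod.mk 0 p)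
      map_add' := fun p p' => by
        have h := ProdMod.mk_add (P := P) (Q := Q) 0 0 p p'
        rw [add_zero] at h
        rw [h, map_add]
      map_smul' := fun r p => by
        have h := ProdMod.smul_mk (P := P) (Q := Q) (0 : R) r 0 p
        rw [smul_zero] at h
        rw [← h, LinearMap.map_smulₛₗ]
        rfl }
    (by ext p; exact BaseChange.lift_ι _ _ _)
    (BaseChange.hom_ext fun x => by
      obtain ⟨p, q⟩ := x
      have h := ProdMod.smul_mk (0 : R) (1 : S) p q
      rw [one_smul, zero_smul] at h
      have h' := LinearMap.map_smulₛₗ (BaseChange.ι (RingHom.snd R S) (ProdMod P Q))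
        ((0, 1) : R × S) (ProdMod.mk p q)
      rw [h, RingHom.coe_snd, one_smul] at h'
      exact (congrArg (fun z => BaseChange.ι (RingHom.snd R S) (ProdMod P Q) (ProdMod.mk 0 z))
        (BaseChange.lift_ι (RingHom.snd R S) _ (ProdMod.mk p q))).trans h')

variable (M : Type w) [AddCommGroup M] [Module (R × S) M]

/-- The canonical map from an `R × S`-module to the sum of its two base changes. -/
def ProdMod.unit : M →ₗ[R × S]
    ProdMod (BaseChange (RingHom.fst R S) M) (BaseChange (RingHom.snd R S) M) where
  toFun x := (BaseChange.ι _ M x, BaseChange.ι _ M x)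
  map_add' x y := Prod.ext (map_add _ x y) (map_add _ x y)
  map_smul' a x := Prod.ext (LinearMap.map_smulₛₗ (BaseChange.ι (RingHom.fst R S) M) a x)
    (LinearMap.map_smulₛₗ (BaseChange.ι (RingHom.snd R S) M) a x)

theorem ProdMod.unit_bijective [Module.Finite (R × S) M] [Module.Projective (R × S) M] :
    Function.Bijective (ProdMod.unit (R := R) (S := S) M) := by
  obtain ⟨n, i, q, h⟩ := BaseChange.exists_retract (R := R × S) M
  have h₁ := BaseChange.map_comp_map (RingHom.fst R S) _ _ h
  have h₂ := BaseChange.map_comp_map (RingHom.snd R S) _ _ h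
  constructor
  · refine (injective_iff_map_eq_zero _).2 fun x hx => ?_
    have e₁ : BaseChange.ι (RingHom.fst R S) M x = 0 := congrArg Prod.fst hx
    have e₂ : BaseChange.ι (RingHom.snd R S) M x = 0 := congrArg Prod.snd hx
    have hi : i x = 0 := by
      funext k
      refine Prod.ext ?_ ?_
      · have := BaseChange.piEquiv_ι (RingHom.fst R S) n (i x) k
        rw [← BaseChange.map_ι, e₁] at this
        simpa using this.symm
      · have := BaseChange.piEquiv_ι (RingHom.snd R S) n (i x) k
        rw [← BaseChange.map_ι, e₂] at this
        simpa using this.symm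
    have := LinearMap.congr_fun h x
    simpa [hi] using this.symm
  · rintro ⟨x, y⟩
    let v : Fin n → R × S := fun k =>
      (BaseChange.piEquiv (RingHom.fst R S) n (BaseChange.map (RingHom.fst R S) i x) k,
        BaseChange.piEquiv (RingHom.snd R S) n (BaseChange.map (RingHom.snd R S) i y) k)
    have v₁ : BaseChange.ι (RingHom.fst R S) _ v = BaseChange.map (RingHom.fst R S) i x :=
      (BaseChange.piEquiv (RingHom.fst R S) n).injective
        (funext fun k => BaseChange.piEquiv_ι _ n v k)
    have v₂ : BaseChange.ι (RingHom.snd R S) _ v = BaseChange.map (RingHom.snd R S) i y :=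
      (BaseChange.piEquiv (RingHom.snd R S) n).injective
        (funext fun k => BaseChange.piEquiv_ι _ n v k)
    refine ⟨q v, Prod.ext ?_ ?_⟩
    · change BaseChange.ι (RingHom.fst R S) M (q v) = x
      rw [← BaseChange.map_ι, v₁]
      exact LinearMap.congr_fun h₁ x
    · change BaseChange.ι (RingHom.snd R S) M (q v) = y
      rw [← BaseChange.map_ι, v₂]
      exact LinearMap.congr_fun h₂ y

variable (R S)

theorem Vect.prod_bijective : Function.Bijective
    ((Vect.map (RingHom.fst R S)).prod (Vect.map (RingHom.snd R S))) := by
  constructor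
  · intro x y hxy
    induction x using Vect.ind with
    | h M =>
    induction y using Vect.ind with
    | h N =>
    obtain ⟨e₁⟩ := Vect.mk_eq_iff.1 (congrArg Prod.fst hxy)
    obtain ⟨e₂⟩ := Vect.mk_eq_iff.1 (congrArg Prod.snd hxy)
    let e : ProdMod (BaseChange (RingHom.fst R S) M) (BaseChange (RingHom.snd R S) M) ≃ₗ[R × S]
        ProdMod (BaseChange (RingHom.fst R S) N) (BaseChange (RingHom.snd R S) N) :=
      { (e₁.toAddEquiv.prodCongr e₂.toAddEquiv) with
        map_smul' := fun a x => Prod.ext (map_smul e₁ a.1 x.1) (map_smul e₂ a.2 x.2) }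
    exact Vect.mk_eq_iff.2 ⟨(LinearEquiv.ofBijective _ (ProdMod.unit_bijective M)).trans
      (e.trans (LinearEquiv.ofBijective _ (ProdMod.unit_bijective N)).symm)⟩
  · rintro ⟨x, y⟩
    induction x using Vect.ind with
    | h P =>
    induction y using Vect.ind with
    | h Q =>
    exact ⟨Vect.mk (ProdMod P Q), Prod.ext (Vect.mk_eq_iff.2 ⟨ProdMod.fstEquiv P Q⟩)
      (Vect.mk_eq_iff.2 ⟨ProdMod.sndEquiv P Q⟩)⟩

/-- Finitely generated projective modules over a product of two rings. -/
noncomputable def Vect.prodEquiv : Vect (R × S) ≃+ Vect R × Vect S :=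
  AddEquiv.ofBijective _ (Vect.prod_bijective R S)

end Prod

/-! ### The functor `K₀` -/

section KGroup

/-- `K₀(R)`: the Grothendieck group (group completion) of the commutative monoid of isomorphism
classes of finitely generated projective `R`-modules, in the universe of `R`. -/
def K₀ (R : Type w) [Ring R] : Type w := Algebra.GrothendieckAddGroup (Shrink.{w} (Vect R))

noncomputable instance (R : Type w) [Ring R] : AddCommGroup (K₀ R) :=
  inferInstanceAs (AddCommGroup (Algebra.GrothendieckAddGroup (Shrink.{w} (Vect R))))

namespace K₀

variable {R S T : Type w} [Ring R] [Ring S] [Ring T]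

variable (R) in
/-- The class in `K₀(R)` of an isomorphism class of finitely generated projective modules. -/
noncomputable def of : Vect R →+ K₀ R :=
  (Algebra.GrothendieckAddGroup.of (M := Shrink.{w} (Vect R))).comp
    (Shrink.addEquiv (α := Vect R)).symm.toAddMonoidHom

/-- The universal property of `K₀(R)`. -/
noncomputable def lift {G : Type*} [AddCommGroup G] (φ : Vect R →+ G) : K₀ R →+ G :=
  Algebra.GrothendieckAddGroup.lift (φ.comp (Shrink.addEquiv (α := Vect R)).toAddMonoidHom)

@[simp]
theorem lift_of {G : Type*} [AddCommGroup G] (φ : Vect R →+ G) (x : Vect R) :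
    lift φ (of R x) = φ x := by
  have h := DFunLike.congr_fun (Algebra.GrothendieckAddGroup.lift.symm_apply_apply
    (φ.comp (Shrink.addEquiv (α := Vect R)).toAddMonoidHom))
    ((Shrink.addEquiv (α := Vect R)).symm x)
  refine Eq.trans ?_ (h.trans ?_)
  · rfl
  · exact congrArg φ ((Shrink.addEquiv (α := Vect R)).apply_symm_apply x)

theorem hom_ext {G : Type*} [AddCommGroup G] {φ ψ : K₀ R →+ G}
    (h : ∀ x, φ (of R x) = ψ (of R x)) : φ = ψ := by
  refine Algebra.GrothendieckAddGroup.lift.symm.injective (AddMonoidHom.ext fun y => ?_)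
  obtain ⟨x, rfl⟩ := (Shrink.addEquiv (α := Vect R)).symm.surjective y
  exact h x

/-- The homomorphism `K₀(R) → K₀(S)` given by base change. -/
noncomputable def map (f : R →+* S) : K₀ R →+ K₀ S := lift ((of S).comp (Vect.map f))

@[simp]
theorem map_of (f : R →+* S) (x : Vect R) : map f (of R x) = of S (Vect.map f x) := by
  simp [map]

theorem map_id : map (RingHom.id R) = AddMonoidHom.id (K₀ R) :=
  hom_ext fun x => by simp [Vect.map_id]

theorem map_comp (f : R →+* S) (g : S →+* T) : map (g.comp f) = (map g).comp (map f) :=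
  hom_ext fun x => by simp [Vect.map_comp]

/-- `K₀` as a functor from associative rings to abelian groups. -/
@[simps]
noncomputable def functor : RingCat.{w} ⥤ AddCommGrpCat.{w} where
  obj R := AddCommGrpCat.of (K₀ R)
  map f := AddCommGrpCat.ofHom (map f.hom)
  map_id R := by
    ext : 1
    exact map_id
  map_comp f g := by
    ext : 1
    exact map_comp f.hom g.hom

section Prod

variable (R S)

/-- The extension by zero `K₀(R) → K₀(R × S)`. -/
noncomputable def inl : K₀ R →+ K₀ (R × S) :=
  lift ((of (R × S)).comp ((Vect.prodEquiv R S).symm.toAddMonoidHom.comp (AddMonoidHom.inl _ _)))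

/-- The extension by zero `K₀(S) → K₀(R × S)`. -/
noncomputable def inr : K₀ S →+ K₀ (R × S) :=
  lift ((of (R × S)).comp ((Vect.prodEquiv R S).symm.toAddMonoidHom.comp (AddMonoidHom.inr _ _)))

variable {R S}

theorem inl_of (x : Vect R) : inl R S (of R x) = of _ ((Vect.prodEquiv R S).symm (x, 0)) :=
  lift_of _ x

theorem inr_of (x : Vect S) : inr R S (of S x) = of _ ((Vect.prodEquiv R S).symm (0, x)) :=
  lift_of _ x

theorem map_fst_prodEquiv_symm (x : Vect R × Vect S) :
    Vect.map (RingHom.fst R S) ((Vect.prodEquiv R S).symm x) = x.1 :=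
  congrArg Prod.fst ((Vect.prodEquiv R S).apply_symm_apply x)

theorem map_snd_prodEquiv_symm (x : Vect R × Vect S) :
    Vect.map (RingHom.snd R S) ((Vect.prodEquiv R S).symm x) = x.2 :=
  congrArg Prod.snd ((Vect.prodEquiv R S).apply_symm_apply x)

variable (R S)

/-- `K₀(R × S)` with its two projections and the two extensions by zero. -/
noncomputable def bicone : BinaryBicone (AddCommGrpCat.of (K₀ R)) (AddCommGrpCat.of (K₀ S)) where
  pt := AddCommGrpCat.of (K₀ (R × S))
  fst := AddCommGrpCat.ofHom (map (RingHom.fst R S))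
  snd := AddCommGrpCat.ofHom (map (RingHom.snd R S))
  inl := AddCommGrpCat.ofHom (inl R S)
  inr := AddCommGrpCat.ofHom (inr R S)
  inl_fst := by
    refine AddCommGrpCat.hom_ext (hom_ext fun x => ?_)
    simp [inl_of, map_fst_prodEquiv_symm]
  inl_snd := by
    refine AddCommGrpCat.hom_ext (hom_ext fun x => ?_)
    simp [inl_of, map_snd_prodEquiv_symm]
  inr_fst := by
    refine AddCommGrpCat.hom_ext (hom_ext fun x => ?_)
    simp [inr_of, map_fst_prodEquiv_symm]
  inr_snd := by
    refine AddCommGrpCat.hom_ext (hom_ext fun x => ?_)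
    simp [inr_of, map_snd_prodEquiv_symm]

/-- `K₀(R × S)` is the direct sum of `K₀(R)` and `K₀(S)`. -/
noncomputable def biconeIsBilimit : (bicone R S).IsBilimit :=
  isBinaryBilimitOfTotal _ (by
    refine AddCommGrpCat.hom_ext (hom_ext fun x => ?_)
    change inl R S (map (RingHom.fst R S) (of _ x)) + inr R S (map (RingHom.snd R S) (of _ x))
      = of _ x
    rw [map_of, map_of, inl_of, inr_of, ← map_add, ← map_add]
    exact congrArg _ ((Vect.prodEquiv R S).symm_apply_eq.2 (by
      simp only [Prod.mk_add_mk, add_zero, zero_add]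
      rfl)))

/-- The product of two rings is their categorical product. -/
def ringProdIsLimit : IsLimit (BinaryFan.mk (RingCat.ofHom (RingHom.fst R S))
    (RingCat.ofHom (RingHom.snd R S))) :=
  BinaryFan.IsLimit.mk _ (fun a b => RingCat.ofHom (a.hom.prod b.hom))
    (fun _ _ => rfl) (fun _ _ => rfl) fun a b m h₁ h₂ => by
      subst h₁ h₂
      rfl

end Prod

instance : PreservesLimitsOfShape (Discrete WalkingPair) functor.{w} where
  preservesLimit {K} := by
    have : PreservesLimit (pair (K.obj ⟨.left⟩) (K.obj ⟨.right⟩)) functor.{w} :=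
      preservesLimit_of_preserves_limit_cone
        (ringProdIsLimit (K.obj ⟨.left⟩) (K.obj ⟨.right⟩))
        ((isLimitMapConeBinaryFanEquiv functor _ _).symm
          (biconeIsBilimit (K.obj ⟨.left⟩) (K.obj ⟨.right⟩)).isLimit)
    exact preservesLimit_of_iso_diagram functor (diagramIsoPair K).symm

theorem subsingleton (R : Type w) [Ring R] [Subsingleton R] : Subsingleton (K₀ R) := by
  have h : AddMonoidHom.id (K₀ R) = 0 := hom_ext fun x => by
    induction x using Vect.ind with
    | h P =>
      have : Subsingleton P := Module.subsingleton R P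
      have : (Vect.mk P : Vect R) = 0 := Vect.mk_eq_iff.2 ⟨LinearEquiv.ofSubsingleton _ _⟩
      simp [this]
  exact ⟨fun x y => (DFunLike.congr_fun h x).trans (DFunLike.congr_fun h y).symm⟩

instance : PreservesLimitsOfShape (Discrete PEmpty.{1}) functor.{w} := by
  have hR : IsTerminal (RingCat.of PUnit.{w + 1}) :=
    IsTerminal.ofUniqueHom (fun X => RingCat.ofHom
      { toFun := fun _ => PUnit.unit
        map_one' := rfl
        map_mul' := fun _ _ => rfl
        map_zero' := rfl
        map_add' := fun _ _ => rfl }) fun _ _ => by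
      ext
  have hK : IsTerminal (functor.{w}.obj (RingCat.of PUnit.{w + 1})) :=
    haveI : Subsingleton (functor.{w}.obj (RingCat.of PUnit.{w + 1})) :=
      subsingleton PUnit.{w + 1}
    (AddCommGrpCat.isZero_of_subsingleton _).isTerminal
  have : PreservesLimit (Functor.empty.{0} RingCat.{w}) functor.{w} :=
    preservesLimit_of_preserves_limit_cone hR ((isLimitMapConeEmptyConeEquiv functor _).symm hK)
  exact preservesLimitsOfShape_pempty_of_preservesTerminal _

instance : PreservesFiniteProducts functor.{w} := .of_preserves_binary_and_terminal _

end K₀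

end KGroup

end KZero

/-! ### Condensed rings -/

namespace CondensedRing

/-- The condensed abelian group `K₀(A)` of a condensed ring `A`: its value at an extremally
disconnected compact Hausdorff space `S` is `K₀(A(S))`. -/
noncomputable def K₀ (A : Condensed.{u} RingCat.{u + 1}) : Condensed.{u} AddCommGrpCat.{u + 1} :=
  haveI : PreservesFiniteProducts (Stonean.toCompHaus.{u}.op ⋙ A.obj ⋙ KZero.K₀.functor) :=
    haveI := preservesFiniteProducts_op Stonean.toCompHaus.{u}
    ⟨fun _ => inferInstance⟩
  Condensed.ofSheafStonean (Stonean.toCompHaus.op ⋙ A.obj ⋙ KZero.K₀.functor)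

/-- The Stone-Čech compactification `βJ` of a discrete set `J`, as the space of ultrafilters. -/
def beta (J : Type u) : CompHaus.{u} := CompHaus.of (Ultrafilter J)

theorem continuous_map {J K : Type u} (f : J → K) :
    Continuous (Ultrafilter.map f : Ultrafilter J → Ultrafilter K) := by
  refine continuous_generateFrom_iff.2 ?_
  rintro _ ⟨s, rfl⟩
  exact ultrafilter_isOpen_basic (f ⁻¹' s)

/-- The map `βJ → βK` induced by a map of sets `J → K`. -/
def betaMap {J K : Type u} (f : J → K) : beta J ⟶ beta K :=
  CompHausLike.ofHom _ ⟨Ultrafilter.map f, continuous_map f⟩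

/-- The point of `βJ` given by an ultrafilter on `J`. -/
def betaPoint {J : Type u} (ν : Ultrafilter J) : CompHaus.of PUnit.{u + 1} ⟶ beta J :=
  CompHausLike.ofHom _ ⟨fun _ => ν, continuous_const⟩

/-- The restriction of an ultrafilter `μ` on `I` to a subset `J` with `μ(J) = 1`. -/
def restrict {I : Type u} (μ : Ultrafilter I) (J : Set I) (hJ : J ∈ μ) : Ultrafilter J :=
  μ.comap Subtype.val_injective (by simpa using hJ)

/-- A condensed ring `A` is Kaplansky if, for every ultrafilter `μ` on a set `I`, an element of
`colim_{μ(J) = 1} A(βJ)` whose image in `A({μ})` is invertible is the class of an invertible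
element of `A(βJ)` for some `J ⊆ I` with `μ(J) = 1`. An element of this filtered colimit is
represented by some `a ∈ A(βJ)` with `μ(J) = 1`, and `b ∈ A(βJ')` represents the same element if
and only if `a` and `b` agree on `βJ''` for some `J'' ⊆ J ∩ J'` with `μ(J'') = 1`. -/
def IsKaplansky (A : Condensed.{u} RingCat.{u + 1}) : Prop :=
  ∀ (I : Type u) (μ : Ultrafilter I) (J : Set I) (hJ : J ∈ μ) (a : A.obj.obj (op (beta J))),
    IsUnit (A.obj.map (betaPoint (restrict μ J hJ)).op a) →
    ∃ (J' : Set I) (_ : J' ∈ μ) (b : A.obj.obj (op (beta J'))) (_ : IsUnit b)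
      (J'' : Set I) (_ : J'' ∈ μ) (h : J'' ⊆ J) (h' : J'' ⊆ J'),
      A.obj.map (betaMap (Set.inclusion h)).op a = A.obj.map (betaMap (Set.inclusion h')).op b

end CondensedRing

/-! A finitely generated projective module `P` over `A(S)` is the image of an idempotent matrix `e`.
Fix a point `s` of `S` and let `e₀` be the constant idempotent pulled back from the value of `e` at
`s`. The matrix `v = e e₀ + (1 - e)(1 - e₀)` satisfies `e v = v e₀` and equals `1` at `s`. Wherever
`v` is invertible, it identifies `P` with the constant module defined by `e₀`. So it is enough that
a matrix over `A(S)` equal to `1` at `s` is invertible near `s`.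

For a single element this comes from the Kaplansky condition: an extremally disconnected `S` is
projective, hence a retract of `βS`, where the condition applies
(`IsKaplansky.exists_left_inverse`). Since `A` is not commutative, determinants cannot reduce
matrices to elements. Instead, the one-element case says that elements vanishing at `s` lie in the
Jacobson radical of the ideal `germIdeal` of elements vanishing near `s`, and Jacobson radicals pass
to matrices. This gives left inverses near `s`; using it twice gives two-sided ones.

Hence every class in `K₀(A(S))` is, near each point, pulled back from a point. Such a class is glued
from constants along a finite clopen partition, so it comes from a unique locally constant function
with values in `K₀(A(*))`. The counit from locally constant functions is therefore an isomorphism,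
which is discreteness (`CondensedSet.isDiscrete_of_locally`). -/

namespace KZero

/-! ### Idempotent matrices and the projective modules they define. -/

section IdempotentMatrices

variable {R S : Type w} [Ring R] [Ring S] (f : R →+* S) {n : ℕ}
variable {P P' : Type w} [AddCommGroup P] [AddCommGroup P'] [Module R P] [Module R P']

/-- `P` is isomorphic to the image of the idempotent endomorphism of the row space `R^n` given by
right multiplication by `e`. -/
def IsImageOf (e : Matrix (Fin n) (Fin n) R) (P : Type w) [AddCommGroup P] [Module R P] : Prop :=
  ∃ (i : P →ₗ[R] (Fin n → R)) (q : (Fin n → R) →ₗ[R] P),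
    q ∘ₗ i = LinearMap.id ∧ i ∘ₗ q = Matrix.toLinearMapRight' e

theorem exists_isImageOf (P : Type w) [AddCommGroup P] [Module R P] [Module.Finite R P]
    [Module.Projective R P] : ∃ (n : ℕ) (e : Matrix (Fin n) (Fin n) R), IsImageOf e P := by
  obtain ⟨n, i, q, h⟩ := BaseChange.exists_retract (R := R) P
  exact ⟨n, LinearMap.toMatrixRight' (i ∘ₗ q), i, q, h, (LinearEquiv.symm_apply_apply _ _).symm⟩

theorem IsImageOf.mul_self {e : Matrix (Fin n) (Fin n) R} (h : IsImageOf e P) : e * e = e := by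
  obtain ⟨i, q, h₁, h₂⟩ := h
  apply Matrix.toLinearMapRight'.injective
  rw [Matrix.toLinearMapRight'_mul, ← h₂]
  refine LinearMap.ext fun x => ?_
  simpa using congrArg i (LinearMap.congr_fun h₁ _)

theorem IsImageOf.baseChange {e : Matrix (Fin n) (Fin n) R} (h : IsImageOf e P) :
    IsImageOf (e.map f) (BaseChange f P) := by
  obtain ⟨i, q, h₁, h₂⟩ := h
  refine ⟨(BaseChange.piEquiv f n).toLinearMap ∘ₗ BaseChange.map f i,
    BaseChange.map f q ∘ₗ (BaseChange.piEquiv f n).symm.toLinearMap, ?_, ?_⟩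
  · ext1 x
    simpa using LinearMap.congr_fun (BaseChange.map_comp_map f _ _ h₁) x
  -- With `piEquiv` moved to the right-hand side, both maps start from a base change, so they need
  -- only be compared on elements `1 ⊗ v`.
  · have key : ((BaseChange.piEquiv f n).toLinearMap ∘ₗ BaseChange.map f i ∘ₗ BaseChange.map f q)
        = Matrix.toLinearMapRight' (e.map f) ∘ₗ (BaseChange.piEquiv f n).toLinearMap := by
      refine BaseChange.hom_ext fun v => ?_
      have hv : i (q v) = Matrix.vecMul v e := LinearMap.congr_fun h₂ v
      have hp : BaseChange.piEquiv f n (BaseChange.ι f _ v) = f ∘ v :=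
        funext fun k => BaseChange.piEquiv_ι f n v k
      ext k
      simp only [LinearMap.comp_apply, BaseChange.map_ι, LinearEquiv.coe_coe,
        BaseChange.piEquiv_ι, hv, hp, Matrix.toLinearMapRight'_apply]
      exact RingHom.map_vecMul f e v k
    refine LinearMap.ext fun x => ?_
    simpa using LinearMap.congr_fun key ((BaseChange.piEquiv f n).symm x)

/-- Modules attached to conjugate idempotent matrices are isomorphic. -/
theorem IsImageOf.nonempty_linearEquiv {e e' : Matrix (Fin n) (Fin n) R} (h : IsImageOf e P)
    (h' : IsImageOf e' P') (v : (Matrix (Fin n) (Fin n) R)ˣ) (hv : e * v = v * e') :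
    Nonempty (P ≃ₗ[R] P') := by
  obtain ⟨i, q, h₁, h₂⟩ := h
  obtain ⟨i', q', h₁', h₂'⟩ := h'
  have hi (x : P) : q (i x) = x := LinearMap.congr_fun h₁ x
  have hi' (x : P') : q' (i' x) = x := LinearMap.congr_fun h₁' x
  have hq (x) : i (q x) = Matrix.vecMul x e := LinearMap.congr_fun h₂ x
  have hq' (x) : i' (q' x) = Matrix.vecMul x e' := LinearMap.congr_fun h₂' x
  have hv' : (↑v⁻¹ : Matrix (Fin n) (Fin n) R) * e = e' * (↑v⁻¹ : Matrix (Fin n) (Fin n) R) := by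
    rw [Units.inv_mul_eq_iff_eq_mul, ← mul_assoc, ← hv, mul_assoc, Units.mul_inv, mul_one]
  -- Composing the two maps puts `e` or `e'` between `v` and its inverse. The intertwining relation
  -- moves it outside, where it acts as the identity on the image.
  refine ⟨LinearEquiv.ofLinearMap
    (q' ∘ₗ Matrix.toLinearMapRight' (v : Matrix (Fin n) (Fin n) R) ∘ₗ i)
    (q ∘ₗ Matrix.toLinearMapRight' (↑v⁻¹ : Matrix (Fin n) (Fin n) R) ∘ₗ i') ?_ ?_⟩
  · ext x
    simp only [LinearMap.comp_apply, Matrix.toLinearMapRight'_apply, LinearMap.id_apply, hq,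
      Matrix.vecMul_vecMul]
    rw [mul_assoc, hv, ← mul_assoc, Units.inv_mul, one_mul, ← hq', hi', hi']
  · ext x
    simp only [LinearMap.comp_apply, Matrix.toLinearMapRight'_apply, LinearMap.id_apply, hq',
      Matrix.vecMul_vecMul]
    rw [mul_assoc, ← hv', ← mul_assoc, Units.mul_inv, one_mul, ← hq, hi, hi]

/-- If `e` and `e'` are idempotents, then `e e' + (1 - e) (1 - e')` intertwines them. -/
theorem mul_intertwiner {M : Type*} [Ring M] {e e' : M} (h : e * e = e) (h' : e' * e' = e') :
    e * (e * e' + (1 - e) * (1 - e')) = (e * e' + (1 - e) * (1 - e')) * e' := by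
  have h₁ : e * (1 - e) = 0 := by rw [mul_sub, h, mul_one, sub_self]
  have h₂ : (1 - e') * e' = 0 := by rw [sub_mul, h', one_mul, sub_self]
  rw [mul_add, add_mul, ← mul_assoc, ← mul_assoc, h, h₁, mul_assoc e, h', mul_assoc (1 - e), h₂,
    zero_mul, mul_zero]

end IdempotentMatrices

/-! ### Lifting invertibility to matrices through the Jacobson radical. -/

section UnitLifting

variable {R R₀ : Type*} [Ring R] [Ring R₀] {n : Type*} [Fintype n] [DecidableEq n]

/-- The hypothesis on single elements says exactly that `ker φ` lies in the Jacobson radical of the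
left ideal `I`. Matrices with entries in that radical lie in the radical of `I.matrix n`, so `u = 1
+ (u - 1)` has a left inverse modulo `I.matrix n`. -/
theorem exists_left_inverse_matrix (φ : R →+* R₀) (I : Ideal R)
    (h : ∀ a, φ a = 1 → ∃ b, b * a - 1 ∈ I) (u : Matrix n n R) (hu : u.map φ = 1) :
    ∃ v : Matrix n n R, v * u - 1 ∈ I.matrix n := by
  have hker : RingHom.ker φ ≤ I.jacobson := fun x hx => Ideal.mem_jacobson_iff.2 fun y => by
    obtain ⟨b, hb⟩ := h (y * x + 1) (by simp [RingHom.mem_ker.1 hx])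
    exact ⟨b, by simpa [mul_add, mul_assoc] using hb⟩
  have hmem : u - 1 ∈ (I.matrix n).jacobson := Ideal.matrix_jacobson_le I fun i j => hker <| by
    have := congrFun (congrFun hu i) j
    rw [Matrix.map_apply] at this
    rw [RingHom.mem_ker, Matrix.sub_apply, map_sub, this, Matrix.one_apply, Matrix.one_apply]
    split_ifs <;> simp
  obtain ⟨v, hv⟩ := Ideal.mem_jacobson_iff.1 hmem 1
  refine ⟨v, ?_⟩
  convert hv using 1
  noncomm_ring

end UnitLifting

end KZero

/-! ### Elements of `K₀` as differences of classes. -/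

namespace KZero.K₀

/-- The differences form a subgroup `H`. The quotient map by `H` kills all classes of modules, so it
is zero by the universal property. -/
theorem exists_eq_of_sub_of {R : Type w} [Ring R] (x : K₀ R) :
    ∃ p q : Vect R, x = of R p - of R q := by
  let H : AddSubgroup (K₀ R) :=
    { carrier := {x | ∃ p q : Vect R, x = of R p - of R q}
      zero_mem' := ⟨0, 0, (sub_self _).symm⟩
      add_mem' := by
        rintro _ _ ⟨p, q, rfl⟩ ⟨p', q', rfl⟩
        exact ⟨p + p', q + q', by rw [map_add, map_add]; abel⟩
      neg_mem' := by
        rintro _ ⟨p, q, rfl⟩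
        exact ⟨q, p, neg_sub _ _⟩ }
  have h : QuotientAddGroup.mk' H = 0 := hom_ext fun p =>
    (QuotientAddGroup.eq_zero_iff _).2 ⟨p, 0, by simp⟩
  exact (QuotientAddGroup.eq_zero_iff x).1 (DFunLike.congr_fun h x)

end KZero.K₀

/-! ### Restriction maps and germs at a point. -/

namespace CondensedRing

variable (A : Condensed.{u} RingCat.{u + 1}) {S T W : CompHaus.{u}}

/-- The restriction homomorphism `A(S) → A(T)` along a map `T → S`. -/
def res (g : T ⟶ S) : A.obj.obj (op S) →+* A.obj.obj (op T) := (A.obj.map g.op).hom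

theorem res_comp_res (g : T ⟶ S) (h : W ⟶ T) : (res A h).comp (res A g) = res A (h ≫ g) := by
  simp [res]

theorem res_res (g : T ⟶ S) (h : W ⟶ T) (a : A.obj.obj (op S)) :
    res A h (res A g a) = res A (h ≫ g) a :=
  DFunLike.congr_fun (res_comp_res A g h) a

theorem res_id (a : A.obj.obj (op S)) : res A (𝟙 S) a = a := by
  simp [res]

/-- The inclusion of a point. -/
def pointHom (s : S) : CompHaus.of PUnit.{u + 1} ⟶ S :=
  CompHausLike.ofHom _ ⟨fun _ => s, continuous_const⟩

theorem pointHom_comp (t : T) (g : T ⟶ S) : pointHom t ≫ g = pointHom (g t) := rfl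

/-- The map to the point. -/
def toPoint (S : CompHaus.{u}) : S ⟶ CompHaus.of PUnit.{u + 1} :=
  CompHausLike.ofHom _ ⟨fun _ => PUnit.unit, continuous_const⟩

theorem comp_toPoint (g : T ⟶ S) : g ≫ toPoint S = toPoint T := rfl

/-- The left ideal of the elements of `A(S)` that vanish near `s`. -/
def germIdeal (s : S) : Ideal (A.obj.obj (op S)) where
  -- A neighbourhood need not be compact, so vanishing on `U` is tested on all compact Hausdorff
  -- spaces mapping into it.
  carrier := {a | ∃ U ∈ nhds s, ∀ (T : CompHaus.{u}) (g : T ⟶ S), (∀ t, g t ∈ U) → res A g a = 0}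
  zero_mem' := ⟨Set.univ, Filter.univ_mem, fun _ _ _ => map_zero _⟩
  add_mem' := by
    rintro a b ⟨U, hU, ha⟩ ⟨V, hV, hb⟩
    exact ⟨U ∩ V, Filter.inter_mem hU hV, fun T g hg => by
      rw [map_add, ha T g fun t => (hg t).1, hb T g fun t => (hg t).2, add_zero]⟩
  smul_mem' := by
    rintro c a ⟨U, hU, ha⟩
    exact ⟨U, hU, fun T g hg => by rw [smul_eq_mul, map_mul, ha T g hg, mul_zero]⟩

theorem res_pointHom_of_mem_germIdeal {s : S} {a : A.obj.obj (op S)} (h : a ∈ germIdeal A s) :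
    res A (pointHom s) a = 0 := by
  obtain ⟨U, hU, ha⟩ := h
  exact ha _ _ fun _ => mem_of_mem_nhds hU

/-! ### Stone–Čech compactifications of discrete sets. -/

theorem betaMap_comp {I J K : Type u} (f : I → J) (g : J → K) :
    betaMap f ≫ betaMap g = betaMap (g ∘ f) := by
  ext x
  exact Ultrafilter.map_map (x : Ultrafilter I) f g

theorem betaMap_id (I : Type u) : betaMap (id : I → I) = 𝟙 (beta I) := by
  ext x
  exact Ultrafilter.map_id (x : Ultrafilter I)

theorem betaMap_val_restrict {I : Type u} (μ : Ultrafilter I) (J : Set I) (hJ : J ∈ μ) :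
    betaMap (Subtype.val : J → I) (restrict μ J hJ) = μ :=
  Ultrafilter.coe_injective (Filter.map_comap_of_mem (by simpa using hJ))

/-- The clopen subset `βJ` of `βI`. -/
def betaOpen {I : Type u} (J : Set I) : Set (beta I) := {μ : Ultrafilter I | J ∈ μ}

theorem isOpen_betaOpen {I : Type u} (J : Set I) : IsOpen (betaOpen J) :=
  ultrafilter_isOpen_basic J

/-- A map into `βI` which lands in the clopen subset `βJ` factors through it. -/
theorem exists_lift_betaMap {I : Type u} (J : Set I) (g : T ⟶ beta I)
    (hg : ∀ t, g t ∈ betaOpen J) :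
    ∃ h : T ⟶ beta J, h ≫ betaMap (Subtype.val : J → I) = g := by
  have hinj : Function.Injective (Ultrafilter.map (Subtype.val : J → I)) :=
    fun μ ν h => Ultrafilter.coe_injective
      (Filter.map_injective Subtype.val_injective (congrArg Ultrafilter.toFilter h))
  have hemb : Topology.IsClosedEmbedding (Ultrafilter.map (Subtype.val : J → I)) :=
    (continuous_map _).isClosedEmbedding hinj
  have hcomp (t : T) : Ultrafilter.map Subtype.val (restrict (g t) J (hg t)) = g t :=
    betaMap_val_restrict (g t) J (hg t)
  refine ⟨CompHausLike.ofHom _ ⟨fun t => restrict (g t) J (hg t), ?_⟩, ?_⟩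
  · rw [hemb.isInducing.continuous_iff]
    refine Continuous.congr (f := fun t => (g t : Ultrafilter I)) ?_ fun t => (hcomp t).symm
    exact g.hom.hom.continuous
  · ext t
    exact hcomp t

/-- A projective compact Hausdorff space is a retract of the Stone-Čech compactification of its
underlying set. -/
theorem exists_retract_beta (S : CompHaus.{u}) [Projective S] :
    ∃ (i : S ⟶ beta S) (r : beta S ⟶ S), i ≫ r = 𝟙 S := by
  let r : beta S ⟶ S := CompHausLike.ofHom _ ⟨Ultrafilter.extend id, continuous_ultrafilter_extend _⟩
  have : Epi r := (CompHaus.epi_iff_surjective r).2 fun s =>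
    ⟨(pure s : Ultrafilter S), congrFun (ultrafilter_extend_extends (id : S → S)) s⟩
  exact ⟨Projective.factorThru (𝟙 S) r, r, Projective.factorThru_comp _ _⟩

/-! ### Local consequences of the Kaplansky condition. -/

variable {A}

/-- Over `βI`, an element which is invertible at `μ` is invertible on `βJ` for some `J`. -/
theorem IsKaplansky.exists_isUnit_res (hA : IsKaplansky A) {I : Type u} (μ : Ultrafilter I)
    (a : A.obj.obj (op (beta I))) (ha : IsUnit (res A (pointHom (S := beta I) μ) a)) :
    ∃ J ∈ μ, IsUnit (res A (betaMap (Subtype.val : J → I)) a) := by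
  obtain ⟨J', hJ', b, hb, J, hJ, h, h', hab⟩ := hA I μ Set.univ Filter.univ_mem
    (res A (betaMap Subtype.val) a) (by
      change IsUnit (res A (betaPoint _) (res A (betaMap Subtype.val) a))
      rw [res_res]
      have : betaPoint (restrict μ Set.univ Filter.univ_mem) ≫ betaMap Subtype.val
          = pointHom (S := beta I) μ := by
        ext
        exact betaMap_val_restrict μ Set.univ Filter.univ_mem
      exact this ▸ ha)
  refine ⟨J, hJ, ?_⟩
  change res A (betaMap (Set.inclusion h)) (res A (betaMap Subtype.val) a)
    = res A (betaMap (Set.inclusion h')) b at hab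
  rw [res_res, betaMap_comp] at hab
  change res A (betaMap Subtype.val) a = _ at hab
  rw [hab]
  exact hb.map _

/-- Pulled back to `βS`, the element `a` becomes invertible on some `βJ` containing the image of
`s`. The inverse on `βJ` extends to `βS` and is then restricted to `S`; it still inverts `a` on the
trace of `βJ`. -/
theorem IsKaplansky.exists_left_inverse (hA : IsKaplansky A) [Projective S] (s : S)
    (a : A.obj.obj (op S)) (ha : IsUnit (res A (pointHom s) a)) :
    ∃ b, b * a - 1 ∈ germIdeal A s := by
  obtain ⟨i, r, hir⟩ := exists_retract_beta S
  obtain ⟨J, hJ, hu⟩ := hA.exists_isUnit_res (i s : Ultrafilter S) (res A r a) (by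
    rw [res_res]
    have : pointHom (S := beta S) (i s) ≫ r = pointHom s := by
      rw [← pointHom_comp, Category.assoc, hir, Category.comp_id]
    exact this ▸ ha)
  obtain ⟨c, hc⟩ := hu.exists_left_inv
  -- Nonemptiness of `J` gives a retraction `ρ` of `S` onto `J`; pulling `c` back along `betaMap ρ`
  -- extends it to `βS`.
  have hne : Nonempty J := (Ultrafilter.nonempty_of_mem hJ).to_subtype
  obtain ⟨ρ, hρ⟩ := (Subtype.val_injective (p := (· ∈ J))).hasLeftInverse
  refine ⟨res A (i ≫ betaMap ρ) c, i ⁻¹' betaOpen J, ?_, fun T g hg => ?_⟩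
  · exact ((isOpen_betaOpen J).preimage i.hom.hom.continuous).mem_nhds hJ
  · obtain ⟨h, hh⟩ := exists_lift_betaMap J (g ≫ i) hg
    have hρ' : betaMap Subtype.val ≫ betaMap ρ = 𝟙 (beta J) := by
      rw [betaMap_comp, ← betaMap_id]
      exact congrArg betaMap (funext hρ)
    have h₁ : g ≫ i ≫ betaMap ρ = h := by
      rw [← Category.assoc, ← hh, Category.assoc, hρ', Category.comp_id]
    have h₂ : g = h ≫ betaMap Subtype.val ≫ r := by
      rw [← Category.assoc, hh, Category.assoc, hir, Category.comp_id]
    rw [map_sub, map_mul, map_one, res_res, h₁, h₂, ← res_res, ← res_res, ← map_mul, hc, map_one,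
      sub_self]

/-- Recording that `v'` is again the identity at `s` lets the statement be applied to `v'` in turn.
-/
theorem IsKaplansky.exists_left_inverse_matrix (hA : IsKaplansky A) [Projective S] (s : S) {n : ℕ}
    (v : Matrix (Fin n) (Fin n) (A.obj.obj (op S))) (hv : v.map (res A (pointHom s)) = 1) :
    ∃ v' : Matrix (Fin n) (Fin n) (A.obj.obj (op S)), v'.map (res A (pointHom s)) = 1 ∧
      ∃ U ∈ nhds s, ∀ (T : CompHaus.{u}) (g : T ⟶ S), (∀ t, g t ∈ U) →
        v'.map (res A g) * v.map (res A g) = 1 := by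
  obtain ⟨v', h⟩ := KZero.exists_left_inverse_matrix (res A (pointHom s)) (germIdeal A s)
    (fun a ha => hA.exists_left_inverse s a (ha ▸ isUnit_one)) v hv
  have key (T : CompHaus.{u}) (g : T ⟶ S) (hg : ∀ i j, res A g ((v' * v - 1) i j) = 0) :
      v'.map (res A g) * v.map (res A g) = 1 := by
    have : (v' * v - 1).map (res A g) = 0 := Matrix.ext hg
    rwa [← RingHom.mapMatrix_apply, map_sub, map_mul, map_one, sub_eq_zero] at this
  refine ⟨v', ?_, ?_⟩
  · have := key _ (pointHom s) fun i j => res_pointHom_of_mem_germIdeal A (h i j)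
    rwa [hv, mul_one] at this
  · choose U hU hUa using fun i j => h i j
    refine ⟨⋂ i, ⋂ j, U i j, Filter.iInter_mem.2 fun i => Filter.iInter_mem.2 fun j => hU i j,
      fun T g hg => key T g fun i j => hUa i j T g fun t => ?_⟩
    exact Set.mem_iInter.1 (Set.mem_iInter.1 (hg t) i) j

/-- A matrix over `A(S)` which is the identity at `s` is invertible near `s`. -/
theorem IsKaplansky.exists_isUnit_matrix (hA : IsKaplansky A) [Projective S] (s : S) {n : ℕ}
    (v : Matrix (Fin n) (Fin n) (A.obj.obj (op S))) (hv : v.map (res A (pointHom s)) = 1) :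
    ∃ U ∈ nhds s, ∀ (T : CompHaus.{u}) (g : T ⟶ S), (∀ t, g t ∈ U) →
      IsUnit (v.map (res A g)) := by
  obtain ⟨v', hv', U, hU, h⟩ := hA.exists_left_inverse_matrix s v hv
  -- Near `s`, `v'` has the left inverse `v''` and the right inverse `v`; these coincide, so `v` is
  -- invertible.
  obtain ⟨v'', -, U', hU', h'⟩ := hA.exists_left_inverse_matrix s v' hv'
  refine ⟨U ∩ U', Filter.inter_mem hU hU', fun T g hg => ?_⟩
  have h₁ := h T g fun t => (hg t).1
  have h₂ := h' T g fun t => (hg t).2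
  rw [left_inv_eq_right_inv h₂ h₁] at h₂
  exact ⟨⟨_, _, h₂, h₁⟩, rfl⟩

open KZero in
/-- Finitely generated projective modules over `A(S)` are locally pulled back from a point. -/
theorem IsKaplansky.exists_vect_map_eq (hA : IsKaplansky A) [Projective S] (s : S)
    (x : Vect (A.obj.obj (op S))) :
    ∃ y : Vect (A.obj.obj (op (CompHaus.of PUnit.{u + 1}))), ∃ U ∈ nhds s,
      ∀ (T : CompHaus.{u}) (g : T ⟶ S), (∀ t, g t ∈ U) →
        Vect.map (res A g) x = Vect.map (res A (toPoint T)) y := by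
  induction x using Vect.ind with
  | h P =>
    obtain ⟨n, e, he⟩ := exists_isImageOf (R := A.obj.obj (op S)) P
    let e₀ := (e.map (res A (pointHom s))).map (res A (toPoint S))
    have he₀ : IsImageOf e₀ (BaseChange (res A (toPoint S)) (BaseChange (res A (pointHom s)) P)) :=
      (he.baseChange _).baseChange _
    have hs : e₀.map (res A (pointHom s)) = e.map (res A (pointHom s)) := by
      ext i j
      simp only [e₀, Matrix.map_apply]
      rw [res_res]
      exact res_id A _
    have hg₀ {T : CompHaus.{u}} (g : T ⟶ S) :
        e₀.map (res A g) = (e.map (res A (pointHom s))).map (res A (toPoint T)) := by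
      ext i j
      simp only [e₀, Matrix.map_apply]
      rw [res_res, comp_toPoint]
    let v := e * e₀ + (1 - e) * (1 - e₀)
    -- At `s` the idempotents `e` and `e₀` agree, so `v` becomes `e² + (1 - e)² = 1`.
    obtain ⟨U, hU, h⟩ := hA.exists_isUnit_matrix s v (by
      have hm := (he.baseChange (res A (pointHom s))).mul_self
      have : (1 - e.map (res A (pointHom s))) * (1 - e.map (res A (pointHom s)))
          = 1 - e.map (res A (pointHom s)) := IsIdempotentElem.one_sub hm
      simp only [← RingHom.mapMatrix_apply] at hs hm this ⊢
      rw [map_add, map_mul, map_mul, map_sub, map_sub, map_one, hs, hm, this, add_sub_cancel])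
    refine ⟨Vect.mk (BaseChange (res A (pointHom s)) P), U, hU, fun T g hg => ?_⟩
    obtain ⟨w, hw⟩ := h T g hg
    refine Vect.mk_eq_iff.2 ((he.baseChange (res A g)).nonempty_linearEquiv
      ((he.baseChange (res A (pointHom s))).baseChange (res A (toPoint T))) w ?_)
    have := congrArg (res A g).mapMatrix (mul_intertwiner he.mul_self he₀.mul_self)
    rw [map_mul, map_mul] at this
    rw [hw, ← hg₀]
    exact this

open KZero in
theorem IsKaplansky.exists_k₀_map_eq (hA : IsKaplansky A) [Projective S] (s : S)
    (x : KZero.K₀ (A.obj.obj (op S))) :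
    ∃ y : KZero.K₀ (A.obj.obj (op (CompHaus.of PUnit.{u + 1}))), ∃ U ∈ nhds s,
      ∀ (T : CompHaus.{u}) (g : T ⟶ S), (∀ t, g t ∈ U) →
        K₀.map (res A g) x = K₀.map (res A (toPoint T)) y := by
  obtain ⟨p, q, rfl⟩ := K₀.exists_eq_of_sub_of x
  obtain ⟨p', U, hU, hp⟩ := hA.exists_vect_map_eq s p
  obtain ⟨q', V, hV, hq⟩ := hA.exists_vect_map_eq s q
  refine ⟨K₀.of _ p' - K₀.of _ q', U ∩ V, Filter.inter_mem hU hV, fun T g hg => ?_⟩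
  simp only [map_sub, K₀.map_of]
  rw [hp T g fun t => (hg t).1, hq T g fun t => (hg t).2]

end CondensedRing

/-! ### Clopen subsets and clopen partitions. -/

theorem IsClopen.extremallyDisconnected {X : Type*} [TopologicalSpace X] [ExtremallyDisconnected X]
    {V : Set X} (hV : IsClopen V) : ExtremallyDisconnected V where
  open_closure U hU := by
    rw [← (closure U).preimage_image_eq Subtype.coe_injective,
      ← hV.1.isClosedEmbedding_subtypeVal.closure_image_eq U]
    exact isOpen_induced (ExtremallyDisconnected.open_closure _
      (hV.2.isOpenEmbedding_subtypeVal.isOpenMap U hU))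

/-- On a compact totally disconnected Hausdorff space, there is a locally constant function whose
fibres are subordinate to a given family of neighbourhoods. -/
theorem exists_locallyConstant_fiber_subset {X : Type u} [TopologicalSpace X] [CompactSpace X]
    [T2Space X] [TotallyDisconnectedSpace X] (U : X → Set X) (hU : ∀ x, U x ∈ nhds x) :
    ∃ f : LocallyConstant X (Set X), ∀ x, ∃ y, ∀ z, f z = f x → z ∈ U y := by
  have hV (x : X) : ∃ V : Set X, IsClopen V ∧ x ∈ V ∧ V ⊆ U x := by
    obtain ⟨V, hV, hx, hVU⟩ := isTopologicalBasis_isClopen.mem_nhds_iff.1 (hU x)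
    exact ⟨V, hV, hx, hVU⟩
  choose V hV hx hVU using hV
  obtain ⟨t, ht⟩ := isCompact_univ.elim_nhds_subcover V fun x _ => (hV x).2.mem_nhds (hx x)
  -- The value at `x` records which members of the finite clopen cover contain `x`, so each fibre
  -- lies in one member.
  refine ⟨⟨fun x => {y | y ∈ t ∧ x ∈ V y}, ?_⟩, fun x => ?_⟩
  · refine (IsLocallyConstant.iff_exists_open _).2 fun x => ?_
    refine ⟨⋂ y ∈ t, {z | z ∈ V y ↔ x ∈ V y}, isOpen_biInter_finset fun y _ => ?_,
      Set.mem_iInter₂.2 fun y _ => Iff.rfl, fun z hz => ?_⟩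
    · by_cases h : x ∈ V y
      · simpa [h] using (hV y).2
      · have : {z | z ∈ V y ↔ x ∈ V y} = (V y)ᶜ := by
          ext z
          simp [h]
        exact this ▸ (hV y).compl.2
    · ext y
      exact and_congr_right fun hy => Set.mem_iInter₂.1 hz y hy
  · obtain ⟨y, hy, hxy⟩ := Set.mem_iUnion₂.1 (ht.2 (Set.mem_univ x))
    refine ⟨y, fun z hz => hVU y ?_⟩
    have : y ∈ {y | y ∈ t ∧ z ∈ V y} := by
      change {y | y ∈ t ∧ z ∈ V y} = {y | y ∈ t ∧ x ∈ V y} at hz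
      exact hz ▸ ⟨hy, hxy⟩
    exact this.2

/-! ### A local criterion for discreteness of condensed sets. -/

namespace CondensedSet

open CompHausLike.LocallyConstant Function.Fiber CondensedRing

variable (X : CondensedSet.{u})

/-- Elements of `X(S)` that agree locally are equal. -/
theorem ext_of_locally {S : Stonean.{u}} {x x' : X.obj.obj (op (Stonean.toCompHaus.obj S))}
    (h : ∀ s : S, ∃ U ∈ nhds s, ∀ (T : Stonean.{u}) (g : T ⟶ S), (∀ t, g t ∈ U) →
      X.obj.map (Stonean.toCompHaus.map g).op x = X.obj.map (Stonean.toCompHaus.map g).op x') :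
    x = x' := by
  choose U hU h using h
  obtain ⟨f, hf⟩ := exists_locallyConstant_fiber_subset U hU
  -- `presheaf_ext` takes a locally constant function valued in the sections of a presheaf at the
  -- point; a lifted constant presheaf provides this form.
  let Y : CompHaus.{u}ᵒᵖ ⥤ Type (u + 1) := (Functor.const _).obj (ULift.{u + 1} (Set S))
  let f' : LocallyConstant (Stonean.toCompHaus.obj S)
    (Y.obj (op (CompHaus.of PUnit.{u + 1}))) := f.map ULift.up
  refine presheaf_ext.{u, u + 1} (Y := Y) f' X.obj x x' fun a => ?_
  obtain ⟨y, hy⟩ := hf a.preimage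
  have hcl : IsClopen (X := S) a.1 := by
    obtain ⟨_, b, rfl⟩ := a
    exact f'.isLocallyConstant.isClopen_fiber _
  have hED : ExtremallyDisconnected a.1 := hcl.extremallyDisconnected
  have hc : CompactSpace a.1 := isCompact_iff_compactSpace.1 hcl.1.isCompact
  let T : Stonean.{u} := Stonean.of a.1
  let g : T ⟶ S := CompHausLike.ofHom _ ⟨Subtype.val, continuous_subtype_val⟩
  refine h y T g fun t => hy _ ?_
  have h₁ := (mem_iff_eq_image f' _ a).1 t.2
  exact congrArg ULift.down (h₁.trans (map_preimage_eq_image f' a).symm)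

/-- The counit glues the values of `f`, pulled back from the point, over its fibres; `g` factors
through the fibre of `s`. -/
theorem map_counitAppApp {S T : CompHaus.{u}}
    (f : LocallyConstant S (X.obj.obj (op (CompHaus.of PUnit.{u + 1})))) (g : T ⟶ S) (s : S)
    (h : ∀ t, f (g t) = f s) :
    X.obj.map g.op (counitAppApp.{u, u + 1} S X.obj f) = X.obj.map (toPoint T).op (f s) := by
  let a := Function.Fiber.mk f s
  let k : T ⟶ fiber.{u, u + 1} f a := CompHausLike.ofHom _ ⟨fun t => ⟨g t, h t⟩, by fun_prop⟩
  have hk : g = k ≫ sigmaIncl.{u, u + 1} f a := rfl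
  rw [hk, op_comp, Functor.map_comp_apply, incl_of_counitAppApp.{u, u + 1}]
  unfold counitAppAppImage
  rw [← Functor.map_comp_apply, ← op_comp]
  exact congrArg _ (mk_image f s)

/-- Restricting the glued section to a point `s` recovers `f s`. -/
theorem counitAppApp_injective (S : CompHaus.{u}) :
    Function.Injective (counitAppApp.{u, u + 1} S X.obj) := by
  intro f g hfg
  ext s
  have h := map_counitAppApp X f (pointHom s) s fun _ => rfl
  rw [hfg, map_counitAppApp X g (pointHom s) s fun _ => rfl] at h
  have h1 : (toPoint (CompHaus.of PUnit.{u + 1})) = 𝟙 _ := rfl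
  simpa [h1] using h.symm

/-- A condensed set is discrete if its sections over extremally disconnected spaces are locally
pulled back from the point. -/
theorem isDiscrete_of_locally
    (h : ∀ (S : Stonean.{u}) (x : X.obj.obj (op (Stonean.toCompHaus.obj S))) (s : S),
      ∃ y : X.obj.obj (op (CompHaus.of PUnit.{u + 1})), ∃ U ∈ nhds s,
        ∀ (T : Stonean.{u}) (g : T ⟶ S), (∀ t, g t ∈ U) →
          X.obj.map (Stonean.toCompHaus.map g).op x
            = X.obj.map (toPoint (Stonean.toCompHaus.obj T)).op y) :
    X.IsDiscrete := by
  refine ((CondensedSet.isDiscrete_tfae X).out 0 4 :).2 ?_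
  let ε := CondensedSet.LocallyConstant.adjunction.counit.app X
  have h₁ : Mono ε := by
    have : ∀ S, Mono (ε.hom.app S) := fun S =>
      (mono_iff_injective _).2 (counitAppApp_injective X S.unop)
    have : Mono ε.hom := NatTrans.mono_of_mono_app _
    exact (sheafToPresheaf _ _).mono_of_mono_map this
  have h₂ : Epi ε := by
    refine (CondensedSet.epi_iff_surjective_on_stonean ε).2 fun S x => ?_
    change X.obj.obj (op (Stonean.toCompHaus.obj S)) at x
    choose y U hU hy using h S x
    have hval (s t : S) (ht : t ∈ U s) : X.obj.map (pointHom t).op x = y s := by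
      let g : Stonean.of PUnit.{u + 1} ⟶ S := CompHausLike.ofHom _ ⟨fun _ => t, continuous_const⟩
      refine (hy s (Stonean.of PUnit.{u + 1}) g fun _ => ht).trans ?_
      exact X.obj.map_id_apply (op (CompHaus.of PUnit.{u + 1})) (y s)
    -- The only possible preimage of `x` is its function of values at points; by `hval` it is
    -- constant on each `U s`.
    let f : LocallyConstant (Stonean.toCompHaus.obj S)
        (X.obj.obj (op (CompHaus.of PUnit.{u + 1}))) :=
      ⟨fun s => X.obj.map (pointHom s).op x, (IsLocallyConstant.iff_eventually_eq _).2 fun s => by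
        filter_upwards [hU s] with t ht
        exact (hval s t ht).trans (hval s s (mem_of_mem_nhds (hU s))).symm⟩
    refine ⟨f, ext_of_locally X fun s => ⟨U s, hU s, fun T g hg => ?_⟩⟩
    have hs : f s = y s := hval s s (mem_of_mem_nhds (hU s))
    rw [hy s T g hg, ← hs]
    exact map_counitAppApp X f _ s fun t => (hval s _ (hg t)).trans hs.symm
  exact isIso_of_mono_of_epi ε

end CondensedSet

/-! ### Transport to `K₀(A)` and conclusion. -/

namespace CondensedRing

/-- The value of `K₀(A)` at an extremally disconnected space `S` is `K₀(A(S))`. -/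
noncomputable def k₀Iso (A : Condensed.{u} RingCat.{u + 1}) :
    Stonean.toCompHaus.{u}.op ⋙ (K₀ A).obj ≅
      Stonean.toCompHaus.{u}.op ⋙ A.obj ⋙ KZero.K₀.functor :=
  (sheafToPresheaf _ _).mapIso
    ((Condensed.StoneanCompHaus.equivalence AddCommGrpCat.{u + 1}).unitIso.app _).symm

end CondensedRing

/-- Needed because `K₀(A)` has the values `K₀(A(S))` only up to the natural isomorphism `k₀Iso`. -/
theorem AddCommGrpCat.map_eq_map_of_iso {C : Type*} [Category* C] {F G : C ⥤ AddCommGrpCat.{w}}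
    (e : F ≅ G) {X Y Z : C} (f : X ⟶ Z) (g : Y ⟶ Z) (x : F.obj X) (y : G.obj Y)
    (h : G.map f (e.hom.app X x) = G.map g y) : F.map f x = F.map g (e.inv.app Y y) := by
  rw [← NatTrans.naturality_apply, ← h, ← NatTrans.naturality_apply e.hom]
  exact (Iso.hom_inv_id_app_apply e _ _).symm

/-- A condensed abelian group is discrete if its underlying condensed set is. -/
theorem Condensed.isDiscrete_of_isDiscrete_forget (F : Condensed.{u} AddCommGrpCat.{u + 1})
    (h : Condensed.IsDiscrete ((sheafCompose (coherentTopology CompHaus.{u})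
      (CategoryTheory.forget AddCommGrpCat.{u + 1})).obj F)) : F.IsDiscrete := by
  have : IsIso ((sheafCompose (coherentTopology CompHaus.{u})
      (CategoryTheory.forget AddCommGrpCat.{u + 1})).map ((constantSheafAdj _ _ CompHaus.isTerminalPUnit).counit.app F)) := by
    have : IsIso ((constantSheafAdj _ (Type (u + 1)) CompHaus.isTerminalPUnit).counit.app
      ((sheafCompose (coherentTopology CompHaus.{u})
        (CategoryTheory.forget AddCommGrpCat.{u + 1})).obj F)) :=
      ((CondensedSet.isDiscrete_tfae _).out 0 1 :).1 h
    -- The forgetful functor carries the counit for groups to the counit for sets up to a comparison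
    -- isomorphism, and it reflects isomorphisms.
    rw [← constantSheafAdj_counit_w]
    exact IsIso.comp_isIso' inferInstance this
  have : IsIso ((constantSheafAdj _ _ CompHaus.isTerminalPUnit).counit.app F) :=
    isIso_of_reflects_iso _ (sheafCompose _ (CategoryTheory.forget AddCommGrpCat.{u + 1}))
  exact ⟨_, ⟨asIso ((constantSheafAdj _ _ CompHaus.isTerminalPUnit).counit.app F)⟩⟩

theorem mainTheorem11 (A : Condensed.{u} RingCat.{u + 1}) (hA : CondensedRing.IsKaplansky A) :
    (CondensedRing.K₀ A).IsDiscrete := by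
  refine Condensed.isDiscrete_of_isDiscrete_forget _ (CondensedSet.isDiscrete_of_locally _ ?_)
  intro S x s
  let e := CondensedRing.k₀Iso A
  let pt : Stonean.{u} := Stonean.of PUnit.{u + 1}
  obtain ⟨y, U, hU, hy⟩ := hA.exists_k₀_map_eq (S := Stonean.toCompHaus.obj S) s
    (e.hom.app (op S) x)
  refine ⟨e.inv.app (op pt) y, U, hU, fun T g hg => ?_⟩
  let p : T ⟶ pt := CompHausLike.ofHom _ ⟨fun _ => PUnit.unit, continuous_const⟩
  exact AddCommGrpCat.map_eq_map_of_iso e g.op p.op x y (hy _ (Stonean.toCompHaus.map g) hg)
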